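/- **Conventions.** Categories are locally small. For a regular cardinal $\kappa$, a poset is *$\kappa$-directed* if each of its subsets of cardinality $<\kappa$ has an upper bound, and an object $M$ of a category $\mathcal K$ is *$\kappa$-presentable* if $\mathrm{Hom}(M,-)$ preserves colimits of $\kappa$-directed diagrams. The *presentability rank* of $M$ is the least regular $\kappa$ such that $M$ is $\kappa$-presentable. For an infinite cardinal $\lambda$, $M$ is *$(<\lambda)$-presentable* if it is $\kappa$-presentable for some regular $\kappa<\lambda+\aleph_1$. For regular $\mu,\theta$, the category $\mathcal K$ is *$(\mu,\theta)$-accessible* if it has $\mu$-directed colimits, has only a set of $\theta$-presentable objects up to isomorphism, and every object is the colimit of a $\mu$-directed diagram of $\theta$-presentable objects; it is *$\mu$-accessible* if it is $(\mu,\mu)$-accessible, and *accessible* if it is $\kappa$-accessible for some regular $\kappa$. For regular $\mu<\lambda$, write $\mu\triangleleft\lambda$ if for every cardinal $\theta<\lambda$ the poset $[\theta]^{<\mu}$ of subsets of $\theta$ of cardinality $<\mu$, ordered by inclusion, has a cofinal subset of cardinality $<\lambda$. For $\mu$ regular and $\lambda$ singular, write $\mu\triangleleft\lambda$ if for every $\lambda_0<\lambda$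 there is a regular $\lambda_0'\in(\lambda_0,\lambda]$ with $\mu\triangleleft\lambda_0'$. An object $M$ is *filtrable* if it has a presentability rank $\rho$ and there are a regular cardinal $\kappa<\rho$ and a diagram $\langle M_i : i<\kappa\rangle$ of $(<\rho)$-presentable objects, indexed by the well-ordered set $\kappa$, with colimit $M$. For a regular cardinal $\rho$, an accessible category is *$\rho$-filtrable* if each of its objects of presentability rank $\rho$ is filtrable, and *almost $\rho$-filtrable* if each of its objects of presentability rank $\rho$ is a retract of a filtrable $\rho$-presentable object. **Theorem.** Let $\mu$ be a regular cardinal. Let $\lambda$ be an infinite cardinal such that $\mu\triangleleft\lambda$ and $\mu\triangleleft\lambda^+$. Then: 1. If $\mathcal K$ is a $(\mu,\theta)$-accessible category for some regular $\theta\le\lambda$, then $\mathcal K$ is (accessible and) almost $\lambda^+$-filtrable. 2. Every $\mu$-accessible category is $\lambda^+$-filtrable. Moreover (without reference to $\lambda$): 3. Every $\mu$-accessible category is $\mu^+$-filtrable. -/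

import Mathlib

universe w v u

open CategoryTheory Limits Cardinal

namespace Filtration

/-! Throughout, cardinals live in a universe `w`, "small" means `w`-small, and categories are
arbitrary (the accessible ones are locally `w`-small). -/

section SetTheory

/-- The poset `[X]^{<μ}` of subsets of `X` of cardinality less than `μ`, ordered by inclusion. -/
abbrev SmallSubsets (μ : Cardinal.{w}) (X : Type w) : Type w :=
  {s : Set X // #s < μ}

/-- The relation `μ ◁ ν` for regular cardinals `μ < ν`: the cofinality of the poset `[X]^{<μ}`
is less than `ν` for every set `X` of cardinality less than `ν`. -/
structure SharplyLTRegular (μ ν : Cardinal.{w}) : Prop where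
  regular_left : μ.IsRegular
  regular_right : ν.IsRegular
  lt : μ < ν
  cof_lt : ∀ X : Type w, #X < ν → Order.cof (SmallSubsets μ X) < ν

/-- The relation `μ ◁ ν` for `μ` regular and `ν` an arbitrary infinite cardinal. For `ν` singular
it means that for every `ν₀ < ν` there is a regular `ν₁ ∈ (ν₀, ν]` with `μ ◁ ν₁`. -/
def SharplyLT (μ ν : Cardinal.{w}) : Prop :=
  SharplyLTRegular μ ν ∨
    (ℵ₀ ≤ ν ∧ ¬ ν.IsRegular ∧ ∀ ν₀ < ν, ∃ ν₁, ν₀ < ν₁ ∧ ν₁ ≤ ν ∧ SharplyLTRegular μ ν₁)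

end SetTheory

section Presentability

variable (K : Type u) [Category.{v} K]

/-- The objects that are `κ`-presentable (with `κ` a regular cardinal). -/
def presentable (κ : Cardinal.{w}) : ObjectProperty K :=
  fun X ↦ ∃ _ : Fact κ.IsRegular, IsCardinalPresentable X κ

/-- The `(<ν)`-presentable objects: those that are `κ`-presentable for some regular
`κ < ν + ℵ₁`. -/
def presentableLT (ν : Cardinal.{w}) : ObjectProperty K :=
  fun X ↦ ∃ κ < ν + ℵ₁, presentable K κ X

variable {K} in
/-- `κ` is the presentability rank of `X`: the least regular cardinal `κ` such that `X` is
`κ`-presentable. -/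
def HasPresentabilityRank (X : K) (κ : Cardinal.{w}) : Prop :=
  IsLeast {κ' : Cardinal.{w} | presentable K κ' X} κ

/-- `X` is the colimit of a `(μ, <ν)`-system, i.e. of a diagram of `(<ν)`-presentable objects
indexed by a small `μ`-directed poset. -/
def IsColimitOfSystem (μ : Cardinal.{w}) [Fact μ.IsRegular] (ν : Cardinal.{w}) (X : K) : Prop :=
  ∃ (I : Type w) (_ : PartialOrder I) (_ : IsCardinalFiltered I μ),
    (presentableLT K ν).colimitsOfShape I X

/-- `(μ, <ν)`-accessible categories. The existence of `μ`-directed colimits is expressed through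
the (equivalent) existence of `μ`-filtered colimits. -/
structure IsAccessibleLT (μ : Cardinal.{w}) [Fact μ.IsRegular] (ν : Cardinal.{w}) : Prop where
  locallySmall : LocallySmall.{w} K
  hasColimits : HasCardinalFilteredColimits.{w} K μ
  essentiallySmall : ObjectProperty.EssentiallySmall.{w} (presentableLT K ν)
  isColimitOfSystem : ∀ X : K, IsColimitOfSystem K μ ν X

/-- `(μ, θ)`-accessible categories, for `θ` regular. -/
def IsAccessiblePair (μ : Cardinal.{w}) [Fact μ.IsRegular] (θ : Cardinal.{w}) : Prop :=
  θ.IsRegular ∧ IsAccessibleLT K μ (Order.succ θ)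

end Presentability

section Filtrations

variable {K : Type u} [Category.{v} K]

/-- `X` is the colimit of a `(<ν)`-chain, i.e. of a diagram of `(<ν)`-presentable objects indexed
by (the well-order) `κ` for some regular cardinal `κ < ν`. -/
def IsColimitOfChain (ν : Cardinal.{w}) (X : K) : Prop :=
  ∃ κ : Cardinal.{w}, κ.IsRegular ∧ κ < ν ∧
    (presentableLT K ν).colimitsOfShape κ.ord.ToType X

/-- `X` is filtrable: it has a presentability rank `ρ`, and it is the colimit of a
`(<ρ)`-chain. -/
def IsFiltrable (X : K) : Prop :=
  ∃ ρ : Cardinal.{w}, HasPresentabilityRank X ρ ∧ IsColimitOfChain ρ X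

variable (K) in
/-- `K` is a `ν`-filtrable accessible category. -/
structure IsFiltrableCategory (ν : Cardinal.{w}) : Prop where
  accessible : IsAccessibleCategory.{w} K
  filtrable : ∀ X : K, HasPresentabilityRank X ν → IsFiltrable.{w} X

variable (K) in
/-- `K` is an almost `ν`-filtrable accessible category. -/
structure IsAlmostFiltrableCategory (ν : Cardinal.{w}) : Prop where
  accessible : IsAccessibleCategory.{w} K
  exists_retract : ∀ X : K, HasPresentabilityRank X ν →
    ∃ Y : K, IsFiltrable.{w} Y ∧ presentable K ν Y ∧ Nonempty (Retract X Y)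

end Filtrations

end Filtration

namespace Filtration

section SetTheory

/-- Definition of a sequence indexed by a well-order by choosing, at each step, a value that is
suitably related to the previous ones. -/
lemma exists_transfinite_sequence {W : Type*} [LinearOrder W] [WellFoundedLT W] {α : Type*}
    (R : ∀ i : W, (Set.Iio i → α) → α → Prop) (h : ∀ i f, ∃ a, R i f a) :
    ∃ f : W → α, ∀ i, R i (fun j ↦ f j) (f i) := by
  choose g hg using h
  let f : W → α := (wellFounded_lt (α := W)).fix fun i ih ↦ g i fun j ↦ ih j j.2
  refine ⟨f, fun i ↦ ?_⟩
  have hf : f i = g i fun j ↦ f j := (wellFounded_lt (α := W)).fix_eq _ i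
  rw [hf]
  exact hg _ _

/-- A union of fewer than `cof ν` sets of cardinality `< ν` has cardinality `< ν`. -/
lemma mk_iUnion_lt_of_lt_cof {ν : Cardinal.{w}} (hν : ℵ₀ ≤ ν) {ι α : Type w} (s : ι → Set α)
    (hι : #ι < ν.ord.cof) (hs : ∀ i, #(s i) < ν) : #(⋃ i, s i) < ν :=
  (mk_iUnion_le _).trans_lt (mul_lt_of_lt hν
    (hι.trans_le ((Ordinal.cof_le_card _).trans (by simp)))
    (iSup_lt_of_lt_cof_ord hι hs))

lemma mk_Iio_ord_lt {ν : Cardinal.{w}} (i : ν.ord.ToType) : #(Set.Iio i) < ν := by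
  simpa using mk_Iio_lt i

/-- Closing off under a step relation `R` along a sequence of length `μ`. -/
lemma exists_closure {μ ρ : Cardinal.{w}} [Fact μ.IsRegular] (hρ : ρ.IsRegular) (hμρ : μ < ρ)
    {I : Type w} (R : Set I → Set I → Prop)
    (h : ∀ Z : Set I, #Z < ρ → ∃ A : Set I, #A < ρ ∧ R Z A) :
    ∃ U : Set I, #U < ρ ∧ ∀ s ⊆ U, #s < μ → ∃ Z A, s ⊆ Z ∧ R Z A ∧ A ⊆ U := by
  have hμ : μ.IsRegular := Fact.out
  obtain ⟨f, hf⟩ := exists_transfinite_sequence (W := μ.ord.ToType) (α := {A : Set I // #A < ρ})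
    (fun i f A ↦ R (⋃ j, (f j).1) A.1) fun i f ↦ by
      obtain ⟨A, hA, hR⟩ := h (⋃ j, (f j).1) (mk_iUnion_lt_of_lt_cof hρ.aleph0_le _
        (by rw [hρ.cof_ord]; exact (mk_Iio_ord_lt i).trans hμρ) fun j ↦ (f j).2)
      exact ⟨⟨A, hA⟩, hR⟩
  refine ⟨⋃ i, (f i).1, mk_iUnion_lt_of_lt_cof hρ.aleph0_le _
    (by simpa [hρ.cof_ord] using hμρ) fun i ↦ (f i).2, fun s hs hsμ ↦ ?_⟩
  choose j hj using fun x : s ↦ Set.mem_iUnion.1 (hs x.2)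
  have hj' : HasCardinalLT s μ := (hasCardinalLT_iff_cardinal_mk_lt _ _).2 hsμ
  have : NoMaxOrder μ.ord.ToType := Cardinal.noMaxOrder hμ.aleph0_le
  obtain ⟨i, hi⟩ := exists_gt (IsCardinalFiltered.max j hj')
  exact ⟨_, _, fun x hx ↦ Set.mem_iUnion.2 ⟨⟨j ⟨x, hx⟩,
    (leOfHom (IsCardinalFiltered.toMax j hj' ⟨x, hx⟩)).trans_lt hi⟩, hj ⟨x, hx⟩⟩, hf i,
    Set.subset_iUnion (fun i ↦ (f i).1) i⟩

/-- If `μ ◁ ρ`, any subset of cardinality `< ρ` of a `μ`-directed poset is contained in a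
`μ`-directed subset of cardinality `< ρ`. -/
lemma SharplyLTRegular.exists_directed_superset {μ ρ : Cardinal.{w}} [Fact μ.IsRegular]
    (h : SharplyLTRegular μ ρ) {I : Type w} [PartialOrder I] [IsCardinalFiltered I μ]
    (Z : Set I) (hZ : #Z < ρ) : ∃ A : Set I, Z ⊆ A ∧ IsCardinalFiltered A μ ∧ #A < ρ := by
  have : Fact ρ.IsRegular := ⟨h.regular_right⟩
  simp only [← hasCardinalLT_iff_cardinal_mk_lt] at hZ ⊢
  refine SharplyLT.exists_isCardinalFiltered_set_of_exists_cofinal h.lt (fun X hX ↦ ?_) Z hZ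
  obtain ⟨s, hs, hs'⟩ := Order.exists_cof_eq (SmallSubsets μ X)
  let e (t : SmallSubsets μ X) : CardinalDirectedPoset.SetCardinalLT μ X :=
    ⟨t.1, (hasCardinalLT_iff_cardinal_mk_lt _ _).2 t.2⟩
  refine ⟨e '' s, ?_, fun t ↦ ?_⟩
  · rw [hasCardinalLT_iff_cardinal_mk_lt]
    exact mk_image_le.trans_lt (hs'.trans_lt
      (h.cof_lt X ((hasCardinalLT_iff_cardinal_mk_lt _ _).1 hX)))
  · obtain ⟨t', ht', hle⟩ := hs ⟨t.1, (hasCardinalLT_iff_cardinal_mk_lt _ _).1 t.2⟩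
    exact ⟨e t', ⟨t', ht', rfl⟩, hle⟩

lemma SharplyLT.aleph0_le {μ ν : Cardinal.{w}} (h : SharplyLT μ ν) : ℵ₀ ≤ ν := by
  obtain h | h := h
  exacts [h.regular_right.aleph0_le, h.1]

/-- A variant of the singular clause of `SharplyLT` that also covers regular cardinals. -/
lemma SharplyLT.exists_regular {μ ν : Cardinal.{w}} (h : SharplyLT μ ν) {ν₀ : Cardinal.{w}}
    (h₀ : ν₀ < ν) : ∃ ν₁, ν₀ < ν₁ ∧ ν₁ ≤ ν ∧ SharplyLTRegular μ ν₁ := by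
  obtain h | h := h
  exacts [⟨ν, h₀, le_rfl, h⟩, h.2.2 _ h₀]

lemma SharplyLT.sharplyLTRegular_succ {μ ν : Cardinal.{w}} (hν : ℵ₀ ≤ ν)
    (h : SharplyLT μ (Order.succ ν)) : SharplyLTRegular μ (Order.succ ν) :=
  h.resolve_right fun h ↦ h.2.1 (isRegular_succ hν)

/-- `μ ◁ μ⁺` for every regular cardinal `μ`. -/
lemma sharplyLTRegular_succ {μ : Cardinal.{w}} (hμ : μ.IsRegular) :
    SharplyLTRegular μ (Order.succ μ) where
  regular_left := hμ
  regular_right := isRegular_succ hμ.aleph0_le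
  lt := Order.lt_succ μ
  cof_lt X hX := by
    have : Fact μ.IsRegular := ⟨hμ⟩
    obtain ⟨e⟩ : Nonempty (X ↪ μ.ord.ToType) := by
      rw [← Cardinal.le_def]
      simpa using hX
    have : NoMaxOrder μ.ord.ToType := Cardinal.noMaxOrder hμ.aleph0_le
    let f (i : μ.ord.ToType) : SmallSubsets μ X :=
      ⟨e ⁻¹' Set.Iio i, (mk_preimage_of_injective _ _ e.injective).trans_lt (mk_Iio_ord_lt i)⟩
    have hf : IsCofinal (Set.range f) := fun s ↦ by
      have hs : HasCardinalLT s.1 μ := (hasCardinalLT_iff_cardinal_mk_lt _ _).2 s.2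
      obtain ⟨i, hi⟩ := exists_gt (IsCardinalFiltered.max (fun x : s.1 ↦ e x) hs)
      exact ⟨f i, ⟨i, rfl⟩, fun x hx ↦
        (leOfHom (IsCardinalFiltered.toMax (fun x : s.1 ↦ e x) hs ⟨x, hx⟩)).trans_lt hi⟩
    exact ((Order.cof_le hf).trans (mk_range_le.trans (by simp))).trans_lt (Order.lt_succ μ)

/-- A set of cardinality at most `ν` is a union of `cof ν` sets of cardinality `< ν`. -/
lemma exists_cover_cof {ν : Cardinal.{w}} (hν : ℵ₀ ≤ ν) {I : Type w} (hI : #I ≤ ν) :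
    ∃ B : ν.ord.cof.ord.ToType → Set I, (∀ i, #(B i) < ν) ∧ ∀ x, ∃ i, x ∈ B i := by
  obtain ⟨e⟩ : Nonempty (I ↪ ν.ord.ToType) := by
    rw [← Cardinal.le_def]
    simpa using hI
  obtain ⟨s, hs, hs'⟩ := Order.exists_cof_eq ν.ord.ToType
  obtain ⟨g⟩ : Nonempty (ν.ord.cof.ord.ToType ≃ s) := by
    rw [← Cardinal.eq, hs']
    simp
  have : NoMaxOrder ν.ord.ToType := Cardinal.noMaxOrder hν
  refine ⟨fun i ↦ e ⁻¹' Set.Iio (g i).1, fun i ↦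
    (mk_preimage_of_injective _ _ e.injective).trans_lt (mk_Iio_ord_lt _), fun x ↦ ?_⟩
  obtain ⟨y, hy⟩ := exists_gt (e x)
  obtain ⟨z, hz, hyz⟩ := hs y
  exact ⟨g.symm ⟨z, hz⟩, by simpa using hy.trans_le hyz⟩

/-- If `μ ◁ ν`, a `μ`-directed poset of cardinality at most `ν` is the union of an increasing
sequence of length `cof ν` of `μ`-directed subsets of cardinality `< ν`. -/
lemma SharplyLT.exists_chain {μ ν : Cardinal.{w}} [Fact μ.IsRegular] (h : SharplyLT μ ν)
    {I : Type w} [PartialOrder I] [IsCardinalFiltered I μ] (hI : #I ≤ ν) :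
    ∃ A : ν.ord.cof.ord.ToType → Set I, Monotone A ∧ (∀ i, IsCardinalFiltered (A i) μ) ∧
      (∀ i, #(A i) < ν) ∧ ∀ x, ∃ i, x ∈ A i := by
  have hν := h.aleph0_le
  obtain ⟨B, hB, hB'⟩ := exists_cover_cof hν hI
  obtain ⟨A, hA⟩ := exists_transfinite_sequence (W := ν.ord.cof.ord.ToType)
    (α := {A : Set I // #A < ν ∧ IsCardinalFiltered A μ})
    (fun i f A ↦ B i ∪ (⋃ j, (f j).1) ⊆ A.1) fun i f ↦ by
      have hZ : #(B i ∪ (⋃ j, (f j).1) : Set I) < ν :=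
        (mk_union_le _ _).trans_lt (add_lt_of_lt hν (hB i)
          (mk_iUnion_lt_of_lt_cof hν _ (mk_Iio_ord_lt i) fun j ↦ (f j).2.1))
      obtain ⟨ν₁, h₁, h₂, h₃⟩ := h.exists_regular hZ
      obtain ⟨A, hA, hA', hA''⟩ := h₃.exists_directed_superset _ h₁
      exact ⟨⟨A, hA''.trans_le h₂, hA'⟩, hA⟩
  refine ⟨fun i ↦ (A i).1, fun i j hij ↦ ?_, fun i ↦ (A i).2.2, fun i ↦ (A i).2.1, fun x ↦ ?_⟩
  · obtain rfl | hij := hij.eq_or_lt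
    · exact le_rfl
    · exact (Set.subset_iUnion (fun j : Set.Iio j ↦ (A j).1) ⟨i, hij⟩).trans
        (Set.subset_union_right.trans (hA j))
  · obtain ⟨i, hi⟩ := hB' x
    exact ⟨i, hA i (Or.inl hi)⟩

/-- A `μ`-directed poset of cardinality at most `μ` has a cofinal chain of length `μ`. -/
lemma exists_cofinal_chain {μ : Cardinal.{w}} [Fact μ.IsRegular] {I : Type w} [PartialOrder I]
    [IsCardinalFiltered I μ] (hI : #I ≤ μ) :
    ∃ f : μ.ord.ToType → I, Monotone f ∧ ∀ x, ∃ i, x ≤ f i := by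
  have := IsCardinalFiltered.nonempty I μ
  have hμ : ℵ₀ ≤ μ := IsRegular.aleph0_le Fact.out
  obtain ⟨e⟩ : Nonempty (I ↪ μ.ord.ToType) := by
    rw [← Cardinal.le_def]
    simpa using hI
  let g := Function.invFun e
  obtain ⟨f, hf⟩ := exists_transfinite_sequence (W := μ.ord.ToType) (α := I)
    (fun i f a ↦ g i ≤ a ∧ ∀ j, f j ≤ a) fun i f ↦ by
      let s : Option (Set.Iio i) → I := fun o ↦ o.elim (g i) f
      have hs : HasCardinalLT (Option (Set.Iio i)) μ := by
        rw [hasCardinalLT_option_iff _ _ hμ, hasCardinalLT_iff_cardinal_mk_lt]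
        exact mk_Iio_ord_lt i
      exact ⟨IsCardinalFiltered.max s hs, leOfHom (IsCardinalFiltered.toMax s hs none),
        fun j ↦ leOfHom (IsCardinalFiltered.toMax s hs (some j))⟩
  refine ⟨f, fun i j hij ↦ ?_, fun x ↦ ⟨e x, ?_⟩⟩
  · obtain rfl | hij := hij.eq_or_lt
    · exact le_rfl
    · exact (hf j).2 ⟨i, hij⟩
  · simpa [g, Function.leftInverse_invFun e.injective x] using (hf (e x)).1

end SetTheory

end Filtration

namespace Filtration

section PartialColimits

variable {K : Type u} [Category.{v} K] {I : Type w} [PartialOrder I]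

/-- The poset of `μ`-directed subsets of `I`. -/
abbrev DirectedSubsets (μ : Cardinal.{w}) [Fact μ.IsRegular] (I : Type w) [PartialOrder I] :
    Type w :=
  {A : Set I // IsCardinalFiltered A μ}

/-- The restriction of a diagram to a subset of the indexing poset. -/
abbrev restrict (D : I ⥤ K) (A : Set I) : A ⥤ K :=
  (Subtype.mono_coe (· ∈ A)).functor ⋙ D

variable (μ : Cardinal.{w}) [Fact μ.IsRegular] [HasCardinalFilteredColimits.{w} K μ]

lemma hasColimit_restrict (D : I ⥤ K) (A : DirectedSubsets μ I) :
    HasColimit (restrict D A.1) := by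
  have := A.2
  have := HasCardinalFilteredColimits.hasColimitsOfShape (κ := μ) K A.1
  infer_instance

attribute [local instance] hasColimit_restrict

/-- For `A ≤ B`, the comparison morphism between the colimits of the restrictions of a diagram. -/
noncomputable def restrictMap (D : I ⥤ K) {A B : DirectedSubsets μ I} (h : A ≤ B) :
    colimit (restrict D A.1) ⟶ colimit (restrict D B.1) :=
  colimit.desc (restrict D A.1)
    { pt := colimit (restrict D B.1)
      ι :=
        { app a := colimit.ι (restrict D B.1) ⟨a.1, h a.2⟩
          naturality a b g := by
            have hab : (⟨a.1, h a.2⟩ : B.1) ⟶ ⟨b.1, h b.2⟩ := homOfLE (leOfHom g)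
            exact (colimit.w (restrict D B.1) hab).trans (Category.comp_id _).symm } }

lemma ι_restrictMap (D : I ⥤ K) {A B : DirectedSubsets μ I} (h : A ≤ B) (a : A.1) :
    colimit.ι (restrict D A.1) a ≫ restrictMap μ D h =
      colimit.ι (restrict D B.1) ⟨a.1, h a.2⟩ :=
  colimit.ι_desc _ _

/-- The colimits of the restrictions of a diagram to the `μ`-directed subsets of the indexing
poset. -/
noncomputable def partialColimit (D : I ⥤ K) : DirectedSubsets μ I ⥤ K where
  obj A := colimit (restrict D A.1)
  map f := restrictMap μ D (leOfHom f)
  map_id A := colimit.hom_ext fun a ↦ by rw [ι_restrictMap, Category.comp_id]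
  map_comp f g := colimit.hom_ext fun a ↦ by
    rw [ι_restrictMap, ← Category.assoc, ι_restrictMap]
    exact (ι_restrictMap μ D (leOfHom g) ⟨a.1, leOfHom f a.2⟩).symm

/-- The inclusion of a member of the diagram in a partial colimit. -/
noncomputable def partialι (D : I ⥤ K) (A : DirectedSubsets μ I) {a : I} (ha : a ∈ A.1) :
    D.obj a ⟶ (partialColimit μ D).obj A :=
  colimit.ι (restrict D A.1) ⟨a, ha⟩

variable {μ} {D : I ⥤ K}

lemma partialι_map {A B : DirectedSubsets μ I} (f : A ⟶ B) {a : I} (ha : a ∈ A.1) :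
    partialι μ D A ha ≫ (partialColimit μ D).map f = partialι μ D B (leOfHom f ha) :=
  ι_restrictMap μ D (leOfHom f) ⟨a, ha⟩

lemma partialι_map_assoc {A B : DirectedSubsets μ I} (f : A ⟶ B) {a : I} (ha : a ∈ A.1) {T : K}
    (g : (partialColimit μ D).obj B ⟶ T) :
    partialι μ D A ha ≫ (partialColimit μ D).map f ≫ g = partialι μ D B (leOfHom f ha) ≫ g := by
  rw [← Category.assoc, partialι_map]

lemma map_partialι (A : DirectedSubsets μ I) {a b : I} (ha : a ∈ A.1) (hb : b ∈ A.1)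
    (f : a ⟶ b) : D.map f ≫ partialι μ D A hb = partialι μ D A ha := by
  have h : (⟨a, ha⟩ : A.1) ⟶ ⟨b, hb⟩ := homOfLE (leOfHom f)
  exact colimit.w (restrict D A.1) h

lemma partialColimit_hom_ext {A : DirectedSubsets μ I} {T : K}
    {f g : (partialColimit μ D).obj A ⟶ T}
    (h : ∀ a (ha : a ∈ A.1), partialι μ D A ha ≫ f = partialι μ D A ha ≫ g) : f = g :=
  colimit.hom_ext fun a ↦ h a.1 a.2

/-- The morphism from a partial colimit to the point of a cocone over the whole diagram. -/
noncomputable def partialDesc (c : Cocone D) (A : DirectedSubsets μ I) :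
    (partialColimit μ D).obj A ⟶ c.pt :=
  colimit.desc (restrict D A.1) (c.whisker (Subtype.mono_coe (· ∈ A.1)).functor)

lemma partialι_partialDesc (c : Cocone D) (A : DirectedSubsets μ I) {a : I} (ha : a ∈ A.1) :
    partialι μ D A ha ≫ partialDesc c A = c.ι.app a :=
  colimit.ι_desc _ _

lemma partialι_partialDesc_assoc (c : Cocone D) (A : DirectedSubsets μ I) {a : I} (ha : a ∈ A.1)
    {T : K} (g : c.pt ⟶ T) :
    partialι μ D A ha ≫ partialDesc c A ≫ g = c.ι.app a ≫ g := by
  rw [← Category.assoc, partialι_partialDesc]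

lemma map_partialDesc (c : Cocone D) {A B : DirectedSubsets μ I} (f : A ⟶ B) :
    (partialColimit μ D).map f ≫ partialDesc c B = partialDesc c A :=
  partialColimit_hom_ext fun a ha ↦ by
    rw [partialι_map_assoc, partialι_partialDesc, partialι_partialDesc]

variable (μ) in
/-- A cocone over a diagram induces a cocone over the diagram of its partial colimits. -/
noncomputable def partialCocone (c : Cocone D) : Cocone (partialColimit μ D) where
  pt := c.pt
  ι :=
    { app A := partialDesc c A
      naturality _ _ f := (map_partialDesc c f).trans (Category.comp_id _).symm }

/-- The colimit of a diagram is the colimit of its partial colimits along any directed family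
of `μ`-directed subsets that covers the indexing poset. -/
theorem nonempty_isColimit_whisker_partialCocone {c : Cocone D} (hc : IsColimit c)
    {Q : Type*} [Preorder Q] [IsDirectedOrder Q] {S : Q → DirectedSubsets μ I} (hS : Monotone S)
    (hcover : ∀ a, ∃ q, a ∈ (S q).1) :
    Nonempty (IsColimit ((partialCocone μ c).whisker hS.functor)) := by
  choose q hq using hcover
  let leg (s : Cocone (hS.functor ⋙ partialColimit μ D)) (p : Q) :
    (partialColimit μ D).obj (S p) ⟶ s.pt := s.ι.app p
  have hleg (s : Cocone (hS.functor ⋙ partialColimit μ D)) {p p' : Q} (h : p ≤ p') :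
      (partialColimit μ D).map (homOfLE (hS h)) ≫ leg s p' = leg s p := s.w (homOfLE h)
  have hcompat (s : Cocone (hS.functor ⋙ partialColimit μ D)) {a : I} {q₁ q₂ : Q}
      (h₁ : a ∈ (S q₁).1) (h₂ : a ∈ (S q₂).1) :
      partialι μ D (S q₁) h₁ ≫ leg s q₁ = partialι μ D (S q₂) h₂ ≫ leg s q₂ := by
    obtain ⟨q₃, h₁₃, h₂₃⟩ := exists_ge_ge q₁ q₂
    rw [← hleg s h₁₃, ← hleg s h₂₃, partialι_map_assoc, partialι_map_assoc]
  let cocone (s : Cocone (hS.functor ⋙ partialColimit μ D)) : Cocone D :=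
    { pt := s.pt
      ι :=
        { app a := partialι μ D (S (q a)) (hq a) ≫ leg s (q a)
          naturality a b f := by
            obtain ⟨q₃, h₁₃, h₂₃⟩ := exists_ge_ge (q a) (q b)
            have ha := hS h₁₃ (hq a)
            have hb := hS h₂₃ (hq b)
            rw [hcompat s (hq a) ha, hcompat s (hq b) hb, ← Category.assoc, map_partialι _ ha hb]
            exact (Category.comp_id _).symm } }
  exact ⟨{
    desc s := hc.desc (cocone s)
    fac s p := partialColimit_hom_ext fun a ha ↦
      (partialι_partialDesc_assoc c (S p) ha _).trans
        ((hc.fac (cocone s) a).trans (hcompat s _ _))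
    uniq s m hm := hc.hom_ext fun a ↦ by
      rw [hc.fac]
      refine Eq.trans ?_ (congrArg (partialι μ D (S (q a)) (hq a) ≫ ·) (hm (q a)))
      exact (partialι_partialDesc_assoc c (S (q a)) (hq a) m).symm }⟩

lemma hasCardinalLT_arrow_of_preorder {J : Type w} [Preorder J] {κ : Cardinal.{w}}
    (hκ : ℵ₀ ≤ κ) (hJ : #J < κ) : HasCardinalLT (Arrow J) κ := by
  have hJ' := (hasCardinalLT_iff_cardinal_mk_lt _ _).2 hJ
  refine (hasCardinalLT_prod hκ hJ' hJ').of_injective (fun f ↦ (f.left, f.right)) ?_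
  rintro ⟨a, b, f⟩ ⟨a', b', f'⟩ h
  obtain ⟨rfl, rfl⟩ := Prod.mk.inj h
  obtain rfl : f = f' := Subsingleton.elim _ _
  rfl

lemma isCardinalPresentable_partialColimit [LocallySmall.{w} K] {κ : Cardinal.{w}}
    [Fact κ.IsRegular] (hD : ∀ a, IsCardinalPresentable (D.obj a) κ) (A : DirectedSubsets μ I)
    (hA : #A.1 < κ) : IsCardinalPresentable ((partialColimit μ D).obj A) κ := by
  have (a : A.1) : IsCardinalPresentable ((restrict D A.1).obj a) κ := hD a.1
  exact isCardinalPresentable_of_isColimit _ (colimit.isColimit (restrict D A.1)) κ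
    (hasCardinalLT_arrow_of_preorder (IsRegular.aleph0_le Fact.out) hA)

/-- The poset of `μ`-directed subsets of cardinality `< ρ`. -/
abbrev SmallDirectedSubsets (μ : Cardinal.{w}) [Fact μ.IsRegular] (ρ : Cardinal.{w})
    (I : Type w) [PartialOrder I] : Type w :=
  {A : DirectedSubsets μ I // #A.1 < ρ}

section

variable {ρ : Cardinal.{w}} [IsCardinalFiltered I μ]

lemma SharplyLTRegular.exists_smallDirectedSubset (h : SharplyLTRegular μ ρ) (Z : Set I)
    (hZ : #Z < ρ) : ∃ A : SmallDirectedSubsets μ ρ I, Z ⊆ A.1.1 := by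
  obtain ⟨A, h₁, h₂, h₃⟩ := h.exists_directed_superset Z hZ
  exact ⟨⟨⟨A, h₂⟩, h₃⟩, h₁⟩

variable [Fact ρ.IsRegular]

lemma SharplyLTRegular.isCardinalFiltered_smallDirectedSubsets (h : SharplyLTRegular μ ρ) :
    IsCardinalFiltered (SmallDirectedSubsets μ ρ I) ρ :=
  isCardinalFiltered_preorder _ _ fun ι f hι ↦ by
    obtain ⟨A, hA⟩ := h.exists_smallDirectedSubset (⋃ i, (f i).1.1)
      (mk_iUnion_lt_of_lt_cof h.regular_right.aleph0_le _
        (by rwa [h.regular_right.cof_ord]) fun i ↦ (f i).2)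
    exact ⟨A, fun i ↦ (Set.subset_iUnion (fun i ↦ (f i).1.1) i).trans hA⟩

/-- If `μ ◁ ρ`, the colimit of a `μ`-directed diagram is the `ρ`-directed colimit of its partial
colimits along `μ`-directed subsets of cardinality `< ρ`. -/
lemma SharplyLTRegular.nonempty_isColimit (h : SharplyLTRegular μ ρ) {c : Cocone D}
    (hc : IsColimit c) :
    Nonempty (IsColimit ((partialCocone μ c).whisker
      (Subtype.mono_coe (fun A : DirectedSubsets μ I ↦ #A.1 < ρ)).functor)) := by
  have := h.isCardinalFiltered_smallDirectedSubsets (I := I)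
  have := isFiltered_of_isCardinalFiltered (SmallDirectedSubsets μ ρ I) ρ
  have := IsFiltered.isDirectedOrder (SmallDirectedSubsets μ ρ I)
  refine nonempty_isColimit_whisker_partialCocone hc _ fun a ↦ ?_
  obtain ⟨A, hA⟩ := h.exists_smallDirectedSubset {a}
    (by simpa using one_lt_aleph0.trans_le h.regular_right.aleph0_le)
  exact ⟨A, hA rfl⟩

/-- If `μ ◁ ρ`, a `ρ`-presentable object that is the colimit of a `μ`-directed diagram of
`ρ`-presentable objects is already the colimit of the restriction of this diagram to a
`μ`-directed subset of cardinality `< ρ`. -/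
theorem SharplyLTRegular.exists_isIso [LocallySmall.{w} K] (h : SharplyLTRegular μ ρ)
    {c : Cocone D} (hc : IsColimit c) (hD : ∀ a, IsCardinalPresentable (D.obj a) ρ)
    [IsCardinalPresentable c.pt ρ] :
    ∃ A : SmallDirectedSubsets μ ρ I, IsIso (partialDesc c A.1) := by
  have := h.isCardinalFiltered_smallDirectedSubsets (I := I)
  have hμ : μ.IsRegular := Fact.out
  obtain ⟨hcolim⟩ := h.nonempty_isColimit hc
  obtain ⟨A₀, s, hs⟩ := IsCardinalPresentable.exists_hom_of_isColimit ρ hcolim (𝟙 c.pt)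
  change c.pt ⟶ (partialColimit μ D).obj A₀.1 at s
  change s ≫ partialDesc c A₀.1 = 𝟙 c.pt at hs
  obtain ⟨U, hU, hU'⟩ := exists_closure (μ := μ) h.regular_right h.lt
    (fun Z A ↦ ∃ (C B : SmallDirectedSubsets μ ρ I) (hAC : A₀.1 ≤ C.1) (hCB : C.1 ≤ B.1),
      Z ⊆ C.1.1 ∧ B.1.1 = A ∧
      partialDesc c C.1 ≫ s ≫ (partialColimit μ D).map (homOfLE (hAC.trans hCB)) =
        (partialColimit μ D).map (homOfLE hCB)) fun Z hZ ↦ by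
      obtain ⟨C, hC⟩ := h.exists_smallDirectedSubset (Z ∪ A₀.1.1)
        ((mk_union_le _ _).trans_lt (add_lt_of_lt h.regular_right.aleph0_le hZ A₀.2))
      have hAC : A₀.1 ≤ C.1 := Set.subset_union_right.trans hC
      have := isCardinalPresentable_partialColimit hD C.1 C.2
      let f : (partialColimit μ D).obj C.1 ⟶ (partialColimit μ D).obj C.1 :=
        partialDesc c C.1 ≫ s ≫ (partialColimit μ D).map (homOfLE hAC)
      have hf : f ≫ partialDesc c C.1 = 𝟙 _ ≫ partialDesc c C.1 := by
        rw [Category.assoc, Category.assoc, map_partialDesc, hs, Category.comp_id,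
          Category.id_comp]
      obtain ⟨B, u, hu⟩ := IsCardinalPresentable.exists_eq_of_isColimit' ρ hcolim (i := C)
        f (𝟙 _) hf
      have hCB : C.1 ≤ B.1 := leOfHom u
      have hu' : f ≫ (partialColimit μ D).map (homOfLE hCB) =
        𝟙 _ ≫ (partialColimit μ D).map (homOfLE hCB) := hu
      refine ⟨B.1.1, B.2, C, B, hAC, hCB, Set.subset_union_left.trans hC, rfl, ?_⟩
      rw [Category.id_comp, Category.assoc, Category.assoc, ← Functor.map_comp] at hu'
      exact hu'
  have hUμ : IsCardinalFiltered U μ := isCardinalFiltered_preorder _ _ fun ι f hι ↦ by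
    obtain ⟨Z, A, hZ, ⟨C, B, -, hCB, hC, rfl, -⟩, hA⟩ := hU' (Set.range fun i ↦ (f i).1)
      (by rintro _ ⟨i, rfl⟩; exact (f i).2) (mk_range_le.trans_lt hι)
    have := C.1.2
    have hι' : HasCardinalLT ι μ := (hasCardinalLT_iff_cardinal_mk_lt _ _).2 hι
    let g (i : ι) : C.1.1 := ⟨(f i).1, hC (hZ ⟨i, rfl⟩)⟩
    exact ⟨⟨(IsCardinalFiltered.max g hι').1, hA (hCB (IsCardinalFiltered.max g hι').2)⟩,
      fun i ↦ leOfHom (IsCardinalFiltered.toMax g hι' i)⟩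
  let V : SmallDirectedSubsets μ ρ I := ⟨⟨U, hUμ⟩, hU⟩
  have hAV : A₀.1 ≤ V.1 := by
    obtain ⟨Z, A, -, ⟨C, B, hAC, hCB, -, rfl, -⟩, hA⟩ := hU' ∅ (Set.empty_subset _)
      (by simpa using hμ.pos)
    exact (hAC.trans hCB).trans hA
  refine ⟨V, s ≫ (partialColimit μ D).map (homOfLE hAV),
    partialColimit_hom_ext fun a ha ↦ ?_, ?_⟩
  · obtain ⟨Z, A, hZ, ⟨C, B, hAC, hCB, hC, rfl, e⟩, hA⟩ := hU' {a} (by simpa using ha)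
      (by simpa using one_lt_aleph0.trans_le hμ.aleph0_le)
    have haC : a ∈ C.1.1 := hC (hZ rfl)
    have hBV : B.1 ≤ V.1 := hA
    have e' := partialι μ D C.1 haC ≫= (e =≫ (partialColimit μ D).map (homOfLE hBV))
    rw [Category.assoc, Category.assoc, ← Functor.map_comp, ← Functor.map_comp,
      partialι_partialDesc_assoc, partialι_map] at e'
    rw [partialι_partialDesc_assoc]
    exact e'.trans (Category.comp_id _).symm
  · rw [Category.assoc, map_partialDesc, hs]

end

end PartialColimits

end Filtration

namespace Filtration

section Main

variable {K : Type u} [Category.{v} K]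

lemma presentable_iff {κ : Cardinal.{w}} [Fact κ.IsRegular] {X : K} :
    presentable K κ X ↔ IsCardinalPresentable X κ :=
  ⟨fun ⟨_, h⟩ ↦ h, fun h ↦ ⟨inferInstance, h⟩⟩

lemma presentableLT_succ_iff {ν : Cardinal.{w}} (hν : ℵ₀ ≤ ν) {X : K} :
    presentableLT K (Order.succ ν) X ↔ ∃ κ ≤ ν, presentable K κ X := by
  have h : ℵ₁ ≤ Order.succ ν := by
    rw [← succ_aleph0]
    exact Order.succ_le_succ hν
  simp only [presentableLT, add_eq_left (hν.trans (Order.le_succ ν)) h, Order.lt_succ_iff]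

lemma presentableLT_succ_eq (θ : Cardinal.{w}) [Fact θ.IsRegular] :
    presentableLT K (Order.succ θ) = isCardinalPresentable K θ := by
  ext X
  rw [presentableLT_succ_iff (IsRegular.aleph0_le Fact.out)]
  constructor
  · rintro ⟨κ, hκ, _, _⟩
    exact isCardinalPresentable_of_le X hκ
  · intro h
    exact ⟨θ, le_rfl, presentable_iff.2 h⟩

variable {μ : Cardinal.{w}} [Fact μ.IsRegular]

/-- The colimit of a `μ`-directed diagram of `μ`-presentable objects indexed by a poset of
cardinality at most `μ` is the colimit of a chain of `μ`-presentable objects. -/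
lemma isColimitOfChain_succ_of_mk_le {X : K} {J : Type w} [PartialOrder J]
    [IsCardinalFiltered J μ] (hJ : #J ≤ μ)
    (hX : (isCardinalPresentable K μ).colimitsOfShape J X) :
    IsColimitOfChain (Order.succ μ) X := by
  obtain ⟨f, hf, hf'⟩ := exists_cofinal_chain hJ
  have := hf.final_functor_iff.2 hf'
  refine ⟨μ, Fact.out, Order.lt_succ μ, ?_⟩
  rw [presentableLT_succ_eq]
  exact ObjectProperty.colimitsOfShape_le_of_final _ hf.functor _ hX

variable [HasCardinalFilteredColimits.{w} K μ]

/-- If `μ ◁ ρ` and `θ ≤ ρ`, a `ρ`-presentable object that is a `μ`-directed colimit of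
`θ`-presentable objects is such a colimit along a `μ`-directed poset of cardinality `< ρ`. -/
lemma SharplyLTRegular.exists_small_presentation [LocallySmall.{w} K] {θ ρ : Cardinal.{w}}
    [Fact θ.IsRegular] [Fact ρ.IsRegular] (h : SharplyLTRegular μ ρ) (hθ : θ ≤ ρ) {X : K}
    [IsCardinalPresentable X ρ] {I : Type w} [PartialOrder I] [IsCardinalFiltered I μ]
    (hX : (isCardinalPresentable K θ).colimitsOfShape I X) :
    ∃ (J : Type w) (_ : PartialOrder J) (_ : IsCardinalFiltered J μ), #J < ρ ∧
      (isCardinalPresentable K θ).colimitsOfShape J X := by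
  obtain ⟨p⟩ := hX
  have : IsCardinalPresentable p.cocone.pt ρ := ‹IsCardinalPresentable X ρ›
  obtain ⟨A, hA⟩ := h.exists_isIso p.isColimit
    fun a ↦ isCardinalPresentable_monotone K hθ _ (p.prop_diag_obj a)
  have := hasColimit_restrict μ p.diag A.1
  let e : colimit (restrict p.diag A.1.1) ≅ X := @asIso _ _ _ _ (partialDesc p.cocone A.1) hA
  exact ⟨A.1.1, inferInstance, A.1.2, A.2,
    ⟨(ObjectProperty.ColimitOfShape.colimit (restrict p.diag A.1.1)
      fun a ↦ p.prop_diag_obj a.1).ofIso e⟩⟩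

/-- If `μ ◁ ν` and `θ ≤ ν`, the colimit of a `μ`-directed diagram of `θ`-presentable objects
indexed by a poset of cardinality at most `ν` is the colimit of a chain of objects that are
presentable below `ν⁺`. -/
lemma SharplyLT.isColimitOfChain_succ [LocallySmall.{w} K] {θ ν : Cardinal.{w}}
    [Fact θ.IsRegular] (h : SharplyLT μ ν) (hθ : θ ≤ ν) {X : K} {J : Type w} [PartialOrder J]
    [IsCardinalFiltered J μ] (hJ : #J ≤ ν)
    (hX : (isCardinalPresentable K θ).colimitsOfShape J X) :
    IsColimitOfChain (Order.succ ν) X := by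
  have hν := h.aleph0_le
  obtain ⟨p⟩ := hX
  obtain ⟨A, hmono, hdir, hcard, hcover⟩ := h.exists_chain hJ
  have hS : Monotone (fun i ↦ (⟨A i, hdir i⟩ : DirectedSubsets μ J)) := hmono
  obtain ⟨hc⟩ := nonempty_isColimit_whisker_partialCocone p.isColimit hS hcover
  refine ⟨ν.ord.cof, isRegular_cof (isSuccLimit_ord hν),
    Order.lt_succ_iff.2 ((Ordinal.cof_le_card _).trans (by simp)), ⟨{
      diag := hS.functor ⋙ partialColimit μ p.diag
      ι := ((partialCocone μ p.cocone).whisker hS.functor).ι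
      isColimit := hc
      prop_diag_obj := fun i ↦ (presentableLT_succ_iff hν).2 ?_ }⟩⟩
  obtain ⟨κ, hκ, hκν, hAκ, hθκ⟩ :
      ∃ κ : Cardinal.{w}, κ.IsRegular ∧ κ ≤ ν ∧ #(A i) < κ ∧ θ ≤ κ := by
    by_cases hr : ν.IsRegular
    · exact ⟨ν, hr, le_rfl, hcard i, hθ⟩
    · have hθ' : θ < ν := hθ.lt_of_ne (by rintro rfl; exact hr Fact.out)
      obtain ⟨κ, h₁, h₂, h₃⟩ := h.exists_regular (max_lt (hcard i) hθ')
      exact ⟨κ, h₃.regular_right, h₂, (le_max_left _ _).trans_lt h₁,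
        ((le_max_right _ _).trans_lt h₁).le⟩
  have : Fact κ.IsRegular := ⟨hκ⟩
  exact ⟨κ, hκν, presentable_iff.2 (isCardinalPresentable_partialColimit
    (fun a ↦ isCardinalPresentable_monotone K hθκ _ (p.prop_diag_obj a)) _ hAκ)⟩

/-- If `μ ◁ ρ` and `θ ≤ ρ`, a category with `μ`-filtered colimits in which every object is a
`μ`-directed colimit of objects from an essentially small class of `θ`-presentable objects is
`ρ`-accessible. -/
lemma SharplyLTRegular.isCardinalAccessibleCategory [LocallySmall.{w} K] {θ ρ : Cardinal.{w}}
    [Fact θ.IsRegular] [Fact ρ.IsRegular] (h : SharplyLTRegular μ ρ) (hθ : θ ≤ ρ)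
    [ObjectProperty.EssentiallySmall.{w} (isCardinalPresentable K θ)]
    (hK : ∀ X : K, ∃ (I : Type w) (_ : PartialOrder I) (_ : IsCardinalFiltered I μ),
      (isCardinalPresentable K θ).colimitsOfShape I X) :
    IsCardinalAccessibleCategory K ρ := by
  have hgen : ((isCardinalPresentable K θ).colimitsCardinalClosure ρ).IsCardinalFilteredGenerator
      ρ :=
    { le_isCardinalPresentable := ObjectProperty.colimitsCardinalClosure_le _ _
        (fun J _ hJ ↦ isClosedUnderColimitsOfShape_isCardinalPresentable K hJ)
        (isCardinalPresentable_monotone K hθ)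
      exists_colimitsOfShape := fun X ↦ by
        obtain ⟨I, _, _, ⟨p⟩⟩ := hK X
        obtain ⟨hc⟩ := h.nonempty_isColimit p.isColimit
        refine ⟨SmallDirectedSubsets μ ρ I, inferInstance,
          h.isCardinalFiltered_smallDirectedSubsets, ⟨{
            diag := _
            ι := _
            isColimit := hc
            prop_diag_obj := fun A ↦ ?_ }⟩⟩
        have := ObjectProperty.isClosedUnderColimitsOfShape_colimitsCardinalClosure
          (isCardinalPresentable K θ) ρ A.1.1
          (hasCardinalLT_arrow_of_preorder h.regular_right.aleph0_le A.2)
        have := hasColimit_restrict μ p.diag A.1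
        exact ObjectProperty.prop_colimit _ (restrict p.diag A.1.1) fun a ↦
          ObjectProperty.le_colimitsCardinalClosure _ _ _ (p.prop_diag_obj a.1) }
  have := hgen.hasCardinalFilteredGenerator
  have : HasCardinalFilteredColimits.{w} K ρ :=
    ⟨fun J _ _ ↦ by
      have := IsCardinalFiltered.of_le J h.lt.le
      exact HasCardinalFilteredColimits.hasColimitsOfShape (κ := μ) K J⟩
  exact { }

end Main

end Filtration

open Filtration

theorem mainTheorem7 {K : Type u} [Category.{v} K] (μ : Cardinal.{w}) [Fact μ.IsRegular] :
    (∀ ν : Cardinal.{w}, Filtration.SharplyLT μ ν → Filtration.SharplyLT μ (Order.succ ν) →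
      (∀ θ : Cardinal.{w}, θ ≤ ν → Filtration.IsAccessiblePair K μ θ →
        Filtration.IsAlmostFiltrableCategory K (Order.succ ν)) ∧
      (IsCardinalAccessibleCategory K μ → Filtration.IsFiltrableCategory K (Order.succ ν))) ∧
    (IsCardinalAccessibleCategory K μ → Filtration.IsFiltrableCategory K (Order.succ μ)) := by
  have hsystem (_ : IsCardinalAccessibleCategory K μ) (X : K) :
      ∃ (I : Type w) (_ : PartialOrder I) (_ : IsCardinalFiltered I μ),
        (isCardinalPresentable K μ).colimitsOfShape I X := by
    obtain ⟨J, _, _, hX⟩ :=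
      (isCardinalFilteredGenerator_isCardinalPresentable K μ).exists_colimitsOfShape X
    obtain ⟨I, _, _, F, _⟩ := IsCardinalFiltered.exists_cardinal_directed J μ
    exact ⟨I, inferInstance, inferInstance,
      ObjectProperty.colimitsOfShape_le_of_final _ F _ hX⟩
  refine ⟨fun ν hν hν' ↦ ?_, fun hK ↦ ⟨⟨μ, inferInstance, hK⟩, fun X hX ↦ ⟨_, hX, ?_⟩⟩⟩
  · have hρ := hν'.sharplyLTRegular_succ hν.aleph0_le
    have : Fact (Order.succ ν).IsRegular := ⟨hρ.regular_right⟩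
    have hchain {θ : Cardinal.{w}} [Fact θ.IsRegular] (hθ : θ ≤ ν) [LocallySmall.{w} K]
        [HasCardinalFilteredColimits.{w} K μ] (X : K)
        (hsys : ∃ (I : Type w) (_ : PartialOrder I) (_ : IsCardinalFiltered I μ),
          (isCardinalPresentable K θ).colimitsOfShape I X)
        (hX : HasPresentabilityRank X (Order.succ ν)) : IsFiltrable.{w} X := by
      obtain ⟨I, _, _, hI⟩ := hsys
      have := presentable_iff.1 hX.1
      obtain ⟨J, _, _, hJ, hJX⟩ :=
        hρ.exists_small_presentation (hθ.trans (Order.le_succ ν)) hI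
      exact ⟨_, hX, hν.isColimitOfChain_succ hθ (Order.lt_succ_iff.1 hJ) hJX⟩
    refine ⟨fun θ hθ ⟨hreg, hK⟩ ↦ ?_, fun hK ↦
      ⟨⟨μ, inferInstance, hK⟩, fun X ↦ hchain ?_ X (hsystem hK X)⟩⟩
    · have : Fact θ.IsRegular := ⟨hreg⟩
      have := hK.locallySmall
      have := hK.hasColimits
      have := hK.essentiallySmall
      have hsys := hK.isColimitOfSystem
      simp only [IsColimitOfSystem] at hsys
      rw [presentableLT_succ_eq] at this hsys
      exact ⟨⟨_, inferInstance,
          hρ.isCardinalAccessibleCategory (hθ.trans (Order.le_succ ν)) hsys⟩,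
        fun X hX ↦ ⟨X, hchain hθ X (hsys X) hX, hX.1, ⟨Retract.refl X⟩⟩⟩
    · obtain ⟨ν₁, -, h₁, h₂⟩ := hν.exists_regular (aleph0_pos.trans_le hν.aleph0_le)
      exact h₂.lt.le.trans h₁
  · have hρ := sharplyLTRegular_succ (μ := μ) Fact.out
    have : Fact (Order.succ μ).IsRegular := ⟨hρ.regular_right⟩
    have := presentable_iff.1 hX.1
    obtain ⟨I, _, _, hI⟩ := hsystem hK X
    obtain ⟨J, _, _, hJ, hJX⟩ := hρ.exists_small_presentation (Order.le_succ μ) hI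
    exact isColimitOfChain_succ_of_mk_le (Order.lt_succ_iff.1 hJ) hJX
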